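/- Let $N\in\{1,2,3,\dots\}\cup\{\infty\}$, and let $\mathbb T^N$ be the $N$-fold (countably infinite if $N=\infty$) product of the unit circle $\mathbb T$, equipped with its normalized Haar measure. For $1\le s<\infty$ let $H^s(\mathbb T^N)$ denote the Hardy space, i.e. the closure in $L^s(\mathbb T^N)$ of the analytic polynomials $\sum_\alpha a_\alpha z^\alpha$ (finite sums over finitely supported multi-indices $\alpha$ of nonnegative integers), with the $L^s$ norm $\|\cdot\|_s$. Let $1\le q<p<\infty$, set $r=\dfrac{pq}{p-q}$, and let $u\in H^r(\mathbb T^N)$. Then the multiplier $M_u: f\mapsto uf$ is a well-defined bounded operator from $H^p(\mathbb T^N)$ to $H^q(\mathbb T^N)$, and its essential norm is $$\|M_u\|_{e,p\to q}:=\inf\bigl\{\|M_u-K\|_{H^p\to H^q}:\ K:H^p(\mathbb T^N)\to H^q(\mathbb T^N)\ \text{compact}\bigr\}=\|u\|_r .$$ -/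

import Mathlib

open MeasureTheory
open scoped ENNReal

noncomputable section

instance circleMeasurableSpace : MeasurableSpace Circle := borel Circle

instance circleBorelSpace : BorelSpace Circle := ⟨rfl⟩

/-- The polytorus `𝕋^N` for `N ∈ ℕ ∪ {∞}`: one unit circle for every `i : ℕ` with `i < N`
(all `i : ℕ` if `N = ∞`), with the product topology, the Borel (= product) σ-algebra and
coordinatewise multiplication. -/
abbrev Polytorus (N : ℕ∞) : Type := {i : ℕ // (i : ℕ∞) < N} → Circle

/-- The normalized Haar measure of the compact group `𝕋^N`. -/
def torusMeasure (N : ℕ∞) : Measure (Polytorus N) := Measure.haarMeasure ⊤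

instance torusMeasure.instIsProbabilityMeasure (N : ℕ∞) :
    IsProbabilityMeasure (torusMeasure N) :=
  ⟨by simpa [torusMeasure] using Measure.haarMeasure_self (G := Polytorus N) (K₀ := ⊤)⟩

/-- The coordinate function `z ↦ z_i` on `𝕋^N`. -/
def torusCoord (N : ℕ∞) (i : {i : ℕ // (i : ℕ∞) < N}) : C(Polytorus N, ℂ) where
  toFun z := (z i : ℂ)
  continuous_toFun := by fun_prop

/-- The (analytic) polynomials `∑ a_α z^α`, with finitely many multi-indices `α ≥ 0` each of
finite support, as continuous functions on `𝕋^N`. -/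
def analyticPolynomials (N : ℕ∞) : Submodule ℂ C(Polytorus N, ℂ) :=
  LinearMap.range
    (MvPolynomial.aeval (torusCoord N) :
      MvPolynomial {i : ℕ // (i : ℕ∞) < N} ℂ →ₐ[ℂ] C(Polytorus N, ℂ)).toLinearMap

/-- The Hardy space `H^p(𝕋^N)`, for `1 ≤ p < ∞` (the only exponents it is used for): the closure of the analytic polynomials in
`L^p(𝕋^N)`, with the `L^p` norm. -/
def hardySpace (N : ℕ∞) (p : ℝ≥0∞) [Fact (1 ≤ p)] : Submodule ℂ (Lp ℂ p (torusMeasure N)) :=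
  ((analyticPolynomials N).map
    (ContinuousMap.toLp (E := ℂ) p (torusMeasure N) ℂ).toLinearMap).topologicalClosure

/-- The essential norm of a bounded operator `T : X → Y`: its distance in the operator norm to
the compact operators from `X` to `Y`. -/
def essentialNorm {X Y : Type*} [NormedAddCommGroup X] [NormedSpace ℂ X]
    [NormedAddCommGroup Y] [NormedSpace ℂ Y] (T : X →L[ℂ] Y) : ℝ :=
  ⨅ K : {K : X →L[ℂ] Y // IsCompactOperator K}, ‖T - K.1‖

end

open Filter Topology

/-! The upper bound is Hölder's inequality with `K = 0`. For the lower bound, let `g` be a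
trigonometric polynomial and `w` a unimodular analytic polynomial with `w * g` analytic. The
functions `x n = w * g * z_i ^ n` lie in `H^p` and have modulus `|g|`, so `‖x n‖` and `‖u * x n‖` do
not depend on `n`. A compact `K` sends some subsequence of them to `0`, hence `‖u g‖_q ≤ ‖M_u - K‖
‖g‖_p`. By density this holds on all of `L^p`, where analyticity no longer matters, and testing it
on `|u|^(r/p)`, the equality case of Hölder, gives `‖u‖_r ≤ ‖M_u - K‖`.

Weak convergence of `x n` is replaced by norm convergence of Cesàro means along every subsequence:
the powers of `z_i` are orthonormal in `L^2`, and uniform boundedness carries the limit over to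
`L^p`. -/

instance torusMeasure.instIsMulLeftInvariant (N : ℕ∞) :
    (torusMeasure N).IsMulLeftInvariant := by
  unfold torusMeasure; infer_instance

instance torusMeasure.instWeaklyRegular (N : ℕ∞) : (torusMeasure N).WeaklyRegular := by
  unfold torusMeasure; infer_instance

/-! ### Compact operators and Cesàro means -/

/-- A compact operator sends a bounded sequence, all of whose subsequences have Cesàro means
tending to zero, to a sequence with a subsequence tending to zero. -/
theorem IsCompactOperator.exists_subseq_tendsto_zero {X Y : Type*}
    [NormedAddCommGroup X] [NormedSpace ℂ X] [NormedAddCommGroup Y] [NormedSpace ℂ Y]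
    {K : X →L[ℂ] Y} (hK : IsCompactOperator K) {x : ℕ → X} {C : ℝ} (hC : ∀ n, ‖x n‖ ≤ C)
    (hx : ∀ φ : ℕ → ℕ, StrictMono φ →
      Tendsto (fun m : ℕ => (m : ℂ)⁻¹ • ∑ j ∈ Finset.range m, x (φ j)) atTop (𝓝 0)) :
    ∃ φ : ℕ → ℕ, StrictMono φ ∧ Tendsto (fun j => K (x (φ j))) atTop (𝓝 0) := by
  obtain ⟨S, hS, hKS⟩ := IsCompactOperator.image_closedBall_subset_compact
    (f := (K : X →ₗ[ℂ] Y)) hK C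
  obtain ⟨y, -, φ, hφ, hy⟩ := hS.tendsto_subseq (x := fun n => K (x n))
    fun n => hKS ⟨x n, by simpa using hC n, rfl⟩
  refine ⟨φ, hφ, ?_⟩
  let : NormedSpace ℝ Y := NormedSpace.restrictScalars ℝ ℂ Y
  -- The means of `K (x (φ j))` tend to `y`, but by linearity they are `K` of the means of `x (φ
  -- j)`, which tend to `0`.
  have h1 := hy.cesaro_smul
  have h2 := (K.continuous.tendsto 0).comp (hx φ hφ)
  have h3 : y = 0 := by
    refine tendsto_nhds_unique h1 ?_
    rw [map_zero] at h2
    refine h2.congr fun m => ?_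
    simp only [Function.comp_apply, map_smul, map_sum]
    rw [← Complex.ofReal_natCast, ← Complex.ofReal_inv]
    rfl
  rw [← h3]
  exact hy

/-! ### Integrals of characters and Cesàro means of their powers -/

theorem torusCoord_norm_apply {N : ℕ∞} (i : {i : ℕ // (i : ℕ∞) < N}) (z : Polytorus N) :
    ‖torusCoord N i z‖ = 1 := by
  exact Circle.norm_coe (z i)

theorem integral_torusCoord_pow_mul_conj {N : ℕ∞} (i : {i : ℕ // (i : ℕ∞) < N}) {m n : ℕ}
    (hmn : m ≠ n) :
    ∫ z, torusCoord N i z ^ m * (starRingEnd ℂ) (torusCoord N i z ^ n) ∂torusMeasure N = 0 := by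
  have hk : (m : ℤ) - n ≠ 0 := by omega
  have key : ∀ z : Polytorus N, torusCoord N i z ^ m * (starRingEnd ℂ) (torusCoord N i z ^ n)
      = ((z i ^ ((m : ℤ) - n) : Circle) : ℂ) := fun z => by
    have : (starRingEnd ℂ) (torusCoord N i z) = (torusCoord N i z)⁻¹ := by
      simp [torusCoord, ← Circle.coe_inv_eq_conj]
    rw [map_pow, this]
    simp only [torusCoord, ContinuousMap.coe_mk, Circle.coe_zpow]
    rw [zpow_sub₀ (Circle.coe_ne_zero _)]
    simp [div_eq_mul_inv]
  simp_rw [key]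
  -- Since `c ^ (m - n) = -1`, translating every coordinate by `c` changes the sign of the
  -- integrand, while invariance of the measure preserves the integral.
  set c : Circle := Circle.exp (Real.pi / ((m : ℤ) - n : ℤ)) with hc
  have hck : ((c ^ ((m : ℤ) - n) : Circle) : ℂ) = -1 := by
    rw [hc, Circle.coe_zpow, Circle.coe_exp, ← Complex.exp_int_mul, ← Complex.exp_pi_mul_I]
    congr 1
    have : (((m : ℤ) - n : ℤ) : ℂ) ≠ 0 := Int.cast_ne_zero.2 hk
    push_cast at this ⊢
    field_simp
  refine integral_eq_zero_of_mul_left_eq_neg (g := fun _ => c) fun z => ?_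
  rw [Pi.mul_apply, mul_zpow, Circle.coe_mul, hck, neg_one_mul]

theorem orthonormal_torusCoord_pow {N : ℕ∞} (i : {i : ℕ // (i : ℕ∞) < N}) :
    Orthonormal ℂ fun n : ℕ =>
      ContinuousMap.toLp (E := ℂ) 2 (torusMeasure N) ℂ (torusCoord N i ^ n) := by
  rw [orthonormal_iff_ite]
  intro m n
  rw [ContinuousMap.inner_toLp]
  simp only [ContinuousMap.pow_apply]
  split_ifs with h
  · subst h
    simp only [RCLike.mul_conj, norm_pow, torusCoord_norm_apply]
    simp
  · exact integral_torusCoord_pow_mul_conj i (Ne.symm h)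

theorem Orthonormal.norm_sum_range_sq {E : Type*} [NormedAddCommGroup E] [InnerProductSpace ℂ E]
    {v : ℕ → E} (hv : Orthonormal ℂ v) (m : ℕ) : ‖∑ j ∈ Finset.range m, v j‖ ^ 2 = m := by
  have h := hv.inner_sum (fun _ => 1) (fun _ => 1) (Finset.range m)
  simp only [one_smul, map_one, mul_one, Finset.sum_const, Finset.card_range,
    inner_self_eq_norm_sq_to_K] at h
  exact_mod_cast (by simpa using h : ((‖∑ j ∈ Finset.range m, v j‖ : ℂ)) ^ 2 = m)

/-- By Pythagoras the mean of `m` orthonormal vectors has norm `m^(-1/2)`; the convention `0⁻¹ = 0`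
covers `m = 0`. -/
theorem Orthonormal.tendsto_cesaro {E : Type*} [NormedAddCommGroup E] [InnerProductSpace ℂ E]
    {v : ℕ → E} (hv : Orthonormal ℂ v) :
    Tendsto (fun m : ℕ => (m : ℂ)⁻¹ • ∑ j ∈ Finset.range m, v j) atTop (𝓝 0) := by
  rw [tendsto_zero_iff_norm_tendsto_zero]
  have h : Tendsto (fun m : ℕ => Real.sqrt ((m : ℝ)⁻¹)) atTop (𝓝 0) := by
    simpa using (tendsto_inv_atTop_nhds_zero_nat (𝕜 := ℝ)).sqrt
  refine h.congr fun m => ?_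
  rw [Real.sqrt_eq_iff_mul_self_eq (by positivity) (by positivity), norm_smul, ← sq, mul_pow,
    hv.norm_sum_range_sq]
  rcases eq_or_ne m 0 with rfl | hm
  · simp
  · simp; field_simp

theorem norm_lp_congr {X : Type*} [MeasurableSpace X] {μ : Measure X} {p : ℝ≥0∞} {f g : Lp ℂ p μ}
    (h : ∀ᵐ x ∂μ, ‖f x‖ = ‖g x‖) : ‖f‖ = ‖g‖ := by
  rw [Lp.norm_def, Lp.norm_def, eLpNorm_congr_norm_ae h]

/-- On a probability space, the `L^p` norm of a function bounded by `1` is controlled by a power of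
its `L^2` norm. -/
theorem eLpNorm_le_eLpNorm_two_rpow {X : Type*} [MeasurableSpace X] {μ : Measure X}
    [IsProbabilityMeasure μ] {p : ℝ≥0∞} (hp : p ≠ ∞) {f : X → ℂ}
    (hf : AEStronglyMeasurable f μ) (h : ∀ x, ‖f x‖ ≤ 1) :
    eLpNorm f p μ ≤ eLpNorm f 2 μ ^ (2 / (max p 2).toReal) := by
  have hs : max p 2 ≠ ∞ := by simp [hp]
  have hs0 : max p 2 ≠ 0 := (lt_of_lt_of_le two_pos (le_max_right _ _)).ne'
  have hs2 : 2 ≤ (max p 2).toReal := by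
    simpa using ENNReal.toReal_mono hs (le_max_right p 2)
  -- Passing to `s = max p 2 ≥ 2` increases the norm, and there `|f|^s ≤ |f|^2` because `|f| ≤ 1`.
  refine (eLpNorm_le_eLpNorm_of_exponent_le (le_max_left p 2) hf).trans ?_
  rw [eLpNorm_eq_lintegral_rpow_enorm_toReal hs0 hs,
    eLpNorm_eq_lintegral_rpow_enorm_toReal two_ne_zero ENNReal.ofNat_ne_top, ← ENNReal.rpow_mul]
  have : 1 / (2 : ℝ≥0∞).toReal * (2 / (max p 2).toReal) = 1 / (max p 2).toReal := by
    simp; field_simp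
  rw [this]
  refine ENNReal.rpow_le_rpow (lintegral_mono fun x => ?_) (by positivity)
  exact ENNReal.rpow_le_rpow_of_exponent_ge (by
    simpa [← ofReal_norm] using h x) (by simpa using hs2)

section Lp

variable {X : Type*} [TopologicalSpace X] [CompactSpace X] [MeasurableSpace X] [BorelSpace X]
  {μ : Measure X} [IsProbabilityMeasure μ]

/-- For uniformly bounded functions, `L^p` convergence to zero for finite `p` follows from `L^2`
convergence. -/
theorem tendsto_toLp_of_tendsto_toLp_two {p : ℝ≥0∞} [Fact (1 ≤ p)] (hp : p ≠ ∞)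
    {f : ℕ → C(X, ℂ)} (h1 : ∀ n x, ‖f n x‖ ≤ 1)
    (h : Tendsto (fun n => ContinuousMap.toLp (E := ℂ) 2 μ ℂ (f n)) atTop (𝓝 0)) :
    Tendsto (fun n => ContinuousMap.toLp (E := ℂ) p μ ℂ (f n)) atTop (𝓝 0) := by
  have hs : max p 2 ≠ ∞ := by simp [hp]
  have hs2 : 0 < (max p 2).toReal :=
    ENNReal.toReal_pos (lt_of_lt_of_le two_pos (le_max_right _ _)).ne' hs
  rw [tendsto_zero_iff_norm_tendsto_zero] at h ⊢
  have h2 := h.rpow_const (p := 2 / (max p 2).toReal) (Or.inr (by positivity))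
  rw [Real.zero_rpow (by positivity)] at h2
  refine squeeze_zero (fun _ => norm_nonneg _) (fun n => ?_) h2
  rw [Lp.norm_def, Lp.norm_def, ENNReal.toReal_rpow,
    eLpNorm_congr_ae (ContinuousMap.coeFn_toLp μ (f n)),
    eLpNorm_congr_ae (ContinuousMap.coeFn_toLp (p := 2) μ (f n))]
  have hfin : eLpNorm (f n) 2 μ ≠ ∞ := by
    rw [← eLpNorm_congr_ae (ContinuousMap.coeFn_toLp (𝕜 := ℂ) (p := 2) μ (f n))]
    exact Lp.eLpNorm_ne_top _
  exact ENNReal.toReal_mono (ENNReal.rpow_ne_top_of_nonneg (by positivity) hfin)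
    (eLpNorm_le_eLpNorm_two_rpow hp (f n).continuous.aestronglyMeasurable (h1 n))

theorem norm_toLp_mul_le {p : ℝ≥0∞} [Fact (1 ≤ p)] (f g : C(X, ℂ)) :
    ‖ContinuousMap.toLp (E := ℂ) p μ ℂ (f * g)‖ ≤
      ‖f‖ * ‖ContinuousMap.toLp (E := ℂ) p μ ℂ g‖ := by
  refine Lp.norm_le_mul_norm_of_ae_le_mul ?_
  filter_upwards [ContinuousMap.coeFn_toLp (𝕜 := ℂ) (p := p) μ (f * g),
    ContinuousMap.coeFn_toLp (𝕜 := ℂ) (p := p) μ g] with x h1 h2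
  rw [h1, h2, ContinuousMap.mul_apply, norm_mul]
  gcongr
  exact f.norm_coe_le_norm x

end Lp

/-- The factor `P` costs only its sup norm; the remaining means of powers of `z_i` are bounded by
`1` and tend to `0` in `L^2`, hence in `L^p`. -/
theorem tendsto_cesaro_toLp_torusCoord_pow_mul {N : ℕ∞} {p : ℝ≥0∞} [Fact (1 ≤ p)] (hp : p ≠ ∞)
    (i : {i : ℕ // (i : ℕ∞) < N}) (P : C(Polytorus N, ℂ)) {φ : ℕ → ℕ} (hφ : StrictMono φ) :
    Tendsto (fun m : ℕ => (m : ℂ)⁻¹ • ∑ j ∈ Finset.range m,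
      ContinuousMap.toLp (E := ℂ) p (torusMeasure N) ℂ (P * torusCoord N i ^ φ j)) atTop (𝓝 0) := by
  set D : ℕ → C(Polytorus N, ℂ) :=
    fun m => (m : ℂ)⁻¹ • ∑ j ∈ Finset.range m, torusCoord N i ^ φ j with hD
  have h2 : Tendsto (fun m => ContinuousMap.toLp (E := ℂ) 2 (torusMeasure N) ℂ (D m)) atTop
      (𝓝 0) := by
    simpa only [hD, map_smul, map_sum] using!
      ((orthonormal_torusCoord_pow i).comp φ hφ.injective).tendsto_cesaro
  have hb : ∀ m z, ‖D m z‖ ≤ 1 := fun m z => by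
    have : ‖∑ j ∈ Finset.range m, torusCoord N i z ^ φ j‖ ≤ m := by
      refine (norm_sum_le _ _).trans ?_
      simp [torusCoord_norm_apply]
    simp only [hD, ContinuousMap.smul_apply, ContinuousMap.sum_apply, ContinuousMap.pow_apply,
      norm_smul, norm_inv, Complex.norm_natCast]
    exact (mul_le_mul_of_nonneg_left this (by positivity)).trans inv_mul_le_one
  have hpt := tendsto_toLp_of_tendsto_toLp_two hp hb h2
  rw [tendsto_zero_iff_norm_tendsto_zero] at hpt ⊢
  refine squeeze_zero (fun _ => norm_nonneg _) (fun m => ?_)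
    (by simpa using hpt.const_mul ‖P‖)
  refine le_trans (le_of_eq ?_) (norm_toLp_mul_le P (D m))
  rw [← map_sum, ← map_smul, hD, mul_smul_comm, Finset.mul_sum]

/-! ### Analytic and trigonometric polynomials -/

section Polynomials

variable {N : ℕ∞}

theorem mul_mem_analyticPolynomials {f g : C(Polytorus N, ℂ)} (hf : f ∈ analyticPolynomials N)
    (hg : g ∈ analyticPolynomials N) : f * g ∈ analyticPolynomials N := by
  obtain ⟨a, rfl⟩ := hf
  obtain ⟨b, rfl⟩ := hg
  exact ⟨a * b, by simp⟩

theorem algebraMap_mem_analyticPolynomials (c : ℂ) :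
    algebraMap ℂ C(Polytorus N, ℂ) c ∈ analyticPolynomials N :=
  ⟨MvPolynomial.C c, by simp⟩

theorem torusCoord_mem_analyticPolynomials (i : {i : ℕ // (i : ℕ∞) < N}) :
    torusCoord N i ∈ analyticPolynomials N :=
  ⟨MvPolynomial.X i, by simp⟩

theorem torusCoord_pow_mem_analyticPolynomials (i : {i : ℕ // (i : ℕ∞) < N}) (n : ℕ) :
    torusCoord N i ^ n ∈ analyticPolynomials N :=
  ⟨MvPolynomial.X i ^ n, by simp⟩

variable (N) in
/-- The algebra of continuous functions which, together with their conjugates, become analytic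
polynomials upon multiplication by some unimodular analytic polynomial. -/
def trigonometricPolynomials : StarSubalgebra ℂ C(Polytorus N, ℂ) where
  carrier := {g | ∃ w ∈ analyticPolynomials N, (∀ z, ‖w z‖ = 1) ∧
    w * g ∈ analyticPolynomials N ∧ w * star g ∈ analyticPolynomials N}
  mul_mem' := by
    rintro f g ⟨v, hv, hv1, hvf, hvf'⟩ ⟨w, hw, hw1, hwg, hwg'⟩
    refine ⟨v * w, mul_mem_analyticPolynomials hv hw, fun z => by simp [hv1, hw1], ?_, ?_⟩
    · rw [mul_mul_mul_comm]
      exact mul_mem_analyticPolynomials hvf hwg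
    · rw [star_mul', mul_mul_mul_comm]
      exact mul_mem_analyticPolynomials hvf' hwg'
  add_mem' := by
    rintro f g ⟨v, hv, hv1, hvf, hvf'⟩ ⟨w, hw, hw1, hwg, hwg'⟩
    have key : ∀ a b : C(Polytorus N, ℂ), v * a ∈ analyticPolynomials N →
        w * b ∈ analyticPolynomials N → v * w * (a + b) ∈ analyticPolynomials N := by
      intro a b ha hb
      rw [show v * w * (a + b) = w * (v * a) + v * (w * b) by ring]
      exact add_mem (mul_mem_analyticPolynomials hw ha) (mul_mem_analyticPolynomials hv hb)
    refine ⟨v * w, mul_mem_analyticPolynomials hv hw, fun z => by simp [hv1, hw1],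
      key f g hvf hwg, ?_⟩
    rw [star_add]
    exact key _ _ hvf' hwg'
  algebraMap_mem' c := by
    refine ⟨1, by simpa using algebraMap_mem_analyticPolynomials (N := N) 1, by simp, ?_, ?_⟩
    · rw [one_mul]
      exact algebraMap_mem_analyticPolynomials c
    · rw [one_mul, ← algebraMap_star_comm]
      exact algebraMap_mem_analyticPolynomials _
  star_mem' := by
    rintro f ⟨v, hv, hv1, hvf, hvf'⟩
    exact ⟨v, hv, hv1, hvf', by rwa [star_star]⟩

theorem torusCoord_mem_trigonometricPolynomials (i : {i : ℕ // (i : ℕ∞) < N}) :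
    torusCoord N i ∈ trigonometricPolynomials N := by
  have hi := torusCoord_mem_analyticPolynomials i
  refine ⟨torusCoord N i, hi, torusCoord_norm_apply i, mul_mem_analyticPolynomials hi hi, ?_⟩
  have : torusCoord N i * star (torusCoord N i) = algebraMap ℂ _ 1 := by
    ext z
    simp [Complex.mul_conj', torusCoord_norm_apply]
  rw [this]
  exact algebraMap_mem_analyticPolynomials 1

theorem topologicalClosure_trigonometricPolynomials :
    (trigonometricPolynomials N).topologicalClosure = ⊤ := by
  refine ContinuousMap.starSubalgebra_topologicalClosure_eq_top_of_separatesPoints _ ?_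
  intro x y hxy
  obtain ⟨i, hi⟩ := Function.ne_iff.1 hxy
  exact ⟨_, ⟨torusCoord N i, torusCoord_mem_trigonometricPolynomials i, rfl⟩,
    fun h => hi (Circle.ext h)⟩

/-- Trigonometric polynomials are uniformly dense in the continuous functions by Stone–Weierstrass,
and these are dense in `L^p` for finite `p`. -/
theorem lp_induction_trigonometricPolynomials {p : ℝ≥0∞} [Fact (1 ≤ p)] (hp : p ≠ ∞)
    {Q : Lp ℂ p (torusMeasure N) → Prop} (hQ : IsClosed {f | Q f})
    (h : ∀ g ∈ trigonometricPolynomials N,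
      Q (ContinuousMap.toLp (E := ℂ) p (torusMeasure N) ℂ g)) (f : Lp ℂ p (torusMeasure N)) :
    Q f := by
  refine (ContinuousMap.toLp_denseRange ℂ (torusMeasure N) ℂ hp).induction_on
    (p := Q) f hQ fun g => ?_
  have hg : g ∈ closure (trigonometricPolynomials N : Set C(Polytorus N, ℂ)) := by
    rw [← StarSubalgebra.topologicalClosure_coe, topologicalClosure_trigonometricPolynomials]
    trivial
  exact closure_minimal (t := {g | Q (ContinuousMap.toLp (E := ℂ) p (torusMeasure N) ℂ g)}) h
    (hQ.preimage (ContinuousLinearMap.continuous _)) hg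

theorem toLp_mem_hardySpace {p : ℝ≥0∞} [Fact (1 ≤ p)] {f : C(Polytorus N, ℂ)}
    (hf : f ∈ analyticPolynomials N) :
    ContinuousMap.toLp (E := ℂ) p (torusMeasure N) ℂ f ∈ hardySpace N p :=
  subset_closure ⟨f, hf, rfl⟩

end Polynomials

/-! ### Multiplication operators -/

section Multiplication

variable {N : ℕ∞} {p q r : ℝ≥0∞} [Fact (1 ≤ p)] [Fact (1 ≤ q)] [Fact (1 ≤ r)]
  [ENNReal.HolderTriple r p q]

variable (N p q r) in
/-- Multiplication `L^r × L^p → L^q` as a continuous bilinear map. -/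
noncomputable def lpMul : Lp ℂ r (torusMeasure N) →L[ℂ] Lp ℂ p (torusMeasure N) →L[ℂ]
    Lp ℂ q (torusMeasure N) :=
  (ContinuousLinearMap.mul ℂ ℂ).holderL (torusMeasure N) r p q

theorem coeFn_lpMul (u : Lp ℂ r (torusMeasure N)) (f : Lp ℂ p (torusMeasure N)) :
    lpMul N p q r u f =ᵐ[torusMeasure N] fun z => u z * f z :=
  (ContinuousLinearMap.mul ℂ ℂ).coeFn_holder u f

theorem norm_lpMul_le (u : Lp ℂ r (torusMeasure N)) (f : Lp ℂ p (torusMeasure N)) :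
    ‖lpMul N p q r u f‖ ≤ ‖u‖ * ‖f‖ := by
  refine ((ContinuousLinearMap.mul ℂ ℂ).norm_holder_apply_apply_le (r := q) u f).trans ?_
  simp

theorem lpMul_toLp (f g : C(Polytorus N, ℂ)) :
    lpMul N p q r (ContinuousMap.toLp (E := ℂ) r (torusMeasure N) ℂ f)
      (ContinuousMap.toLp (E := ℂ) p (torusMeasure N) ℂ g) =
      ContinuousMap.toLp (E := ℂ) q (torusMeasure N) ℂ (f * g) := by
  refine Lp.ext ?_
  filter_upwards [coeFn_lpMul (q := q) (ContinuousMap.toLp (E := ℂ) r (torusMeasure N) ℂ f)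
      (ContinuousMap.toLp (E := ℂ) p (torusMeasure N) ℂ g),
    ContinuousMap.coeFn_toLp (𝕜 := ℂ) (p := r) (torusMeasure N) f,
    ContinuousMap.coeFn_toLp (𝕜 := ℂ) (p := p) (torusMeasure N) g,
    ContinuousMap.coeFn_toLp (𝕜 := ℂ) (p := q) (torusMeasure N) (f * g)] with z h1 h2 h3 h4
  rw [h1, h2, h3, h4, ContinuousMap.mul_apply]

theorem lpMul_mem_hardySpace {u : Lp ℂ r (torusMeasure N)} (hu : u ∈ hardySpace N r)
    {f : Lp ℂ p (torusMeasure N)} (hf : f ∈ hardySpace N p) :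
    lpMul N p q r u f ∈ hardySpace N q := by
  refine map_mem_closure₂ (f := fun u f => lpMul N p q r u f)
    (lpMul N p q r).continuous₂ hu hf ?_
  rintro _ ⟨a, ha, rfl⟩ _ ⟨b, hb, rfl⟩
  exact ⟨a * b, mul_mem_analyticPolynomials ha hb, (lpMul_toLp a b).symm⟩

variable (p q) in
/-- The multiplication operator `M_u : H^p → H^q` for `u ∈ H^r`. -/
noncomputable def hardyMul (u : hardySpace N r) : hardySpace N p →L[ℂ] hardySpace N q :=
  ((lpMul N p q r u).comp (hardySpace N p).subtypeL).codRestrict (hardySpace N q)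
    fun f => lpMul_mem_hardySpace u.2 f.2

theorem norm_hardyMul_le (u : hardySpace N r) : ‖hardyMul p q u‖ ≤ ‖u‖ :=
  ContinuousLinearMap.opNorm_le_bound _ (norm_nonneg _) fun f => norm_lpMul_le u.1 f.1

/-- Multiplying by `w * z_i ^ n` moves `g` into `H^p` without changing any norm, and along a
subsequence it makes the contribution of `K` vanish. -/
theorem norm_lpMul_trigonometricPolynomial_le (hN : 1 ≤ N) (hp : p ≠ ∞) (u : hardySpace N r)
    {K : hardySpace N p →L[ℂ] hardySpace N q} (hK : IsCompactOperator K)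
    {g : C(Polytorus N, ℂ)} (hg : g ∈ trigonometricPolynomials N) :
    ‖lpMul N p q r u (ContinuousMap.toLp (E := ℂ) p (torusMeasure N) ℂ g)‖ ≤
      ‖hardyMul p q u - K‖ * ‖ContinuousMap.toLp (E := ℂ) p (torusMeasure N) ℂ g‖ := by
  obtain ⟨w, -, hw1, hwg, -⟩ := hg
  -- A coordinate exists because `N ≥ 1`.
  let i : {i : ℕ // (i : ℕ∞) < N} := ⟨0, lt_of_lt_of_le (by simp) hN⟩
  let F : ℕ → C(Polytorus N, ℂ) := fun n => w * g * torusCoord N i ^ n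
  let x : ℕ → hardySpace N p := fun n =>
    ⟨ContinuousMap.toLp (E := ℂ) p (torusMeasure N) ℂ (F n), toLp_mem_hardySpace
      (mul_mem_analyticPolynomials hwg (torusCoord_pow_mem_analyticPolynomials i n))⟩
  have hF : ∀ n z, ‖F n z‖ = ‖g z‖ := fun n z => by
    simp [F, hw1, torusCoord_norm_apply]
  have hae : ∀ n, ∀ᵐ z ∂torusMeasure N, ‖(x n : Lp ℂ p (torusMeasure N)) z‖ =
      ‖ContinuousMap.toLp (E := ℂ) p (torusMeasure N) ℂ g z‖ := fun n => by
    filter_upwards [ContinuousMap.coeFn_toLp (𝕜 := ℂ) (p := p) (torusMeasure N) (F n),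
      ContinuousMap.coeFn_toLp (𝕜 := ℂ) (p := p) (torusMeasure N) g] with z h1 h2
    rw [h2, ← hF n, ← h1]
  have hx : ∀ n, ‖x n‖ = ‖ContinuousMap.toLp (E := ℂ) p (torusMeasure N) ℂ g‖ :=
    fun n => norm_lp_congr (hae n)
  have hMx : ∀ n, ‖hardyMul p q u (x n)‖ =
      ‖lpMul N p q r u (ContinuousMap.toLp (E := ℂ) p (torusMeasure N) ℂ g)‖ := fun n => by
    refine norm_lp_congr (f := lpMul N p q r u (x n)) ?_
    filter_upwards [hae n, coeFn_lpMul (q := q) u.1 (x n).1, coeFn_lpMul (q := q) u.1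
      (ContinuousMap.toLp (E := ℂ) p (torusMeasure N) ℂ g)] with z h1 h2 h3
    rw [h2, h3, norm_mul, norm_mul, h1]
  obtain ⟨φ, -, hφ⟩ := hK.exists_subseq_tendsto_zero (fun n => (hx n).le) fun φ hφ => by
    rw [tendsto_subtype_rng]
    simpa [x] using! tendsto_cesaro_toLp_torusCoord_pow_mul hp i (w * g) hφ
  have hlim := hφ.norm.const_add
    (‖hardyMul p q u - K‖ * ‖ContinuousMap.toLp (E := ℂ) p (torusMeasure N) ℂ g‖)
  rw [norm_zero, add_zero] at hlim
  refine ge_of_tendsto' hlim fun n => ?_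
  rw [← hMx (φ n), ← hx (φ n)]
  have h1 := (hardyMul p q u - K).le_opNorm (x (φ n))
  have h2 : hardyMul p q u (x (φ n)) = (hardyMul p q u - K) (x (φ n)) + K (x (φ n)) := by simp
  rw [h2]
  exact (norm_add_le _ _).trans (by gcongr)

theorem norm_lpMul_le_of_isCompactOperator (hN : 1 ≤ N) (hp : p ≠ ∞) (u : hardySpace N r)
    {K : hardySpace N p →L[ℂ] hardySpace N q} (hK : IsCompactOperator K)
    (f : Lp ℂ p (torusMeasure N)) :
    ‖lpMul N p q r u f‖ ≤ ‖hardyMul p q u - K‖ * ‖f‖ :=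
  lp_induction_trigonometricPolynomials hp
    (Q := fun f => ‖lpMul N p q r u f‖ ≤ ‖hardyMul p q u - K‖ * ‖f‖)
    (isClosed_le (by fun_prop) (by fun_prop))
    (fun _ hg => norm_lpMul_trigonometricPolynomial_le hN hp u hK hg) f

/-- The equality case of Hölder's inequality: `|u|^{r/p}` is extremal for multiplication
by `u`. -/
theorem norm_le_of_norm_lpMul_le (hp : p ≠ ∞) (hr : r ≠ ∞) (u : Lp ℂ r (torusMeasure N)) {C : ℝ}
    (hC0 : 0 ≤ C) (hC : ∀ f, ‖lpMul N p q r u f‖ ≤ C * ‖f‖) : ‖u‖ ≤ C := by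
  have hp0 : p ≠ 0 := (zero_lt_one.trans_le Fact.out).ne'
  have hq0 : q ≠ 0 := (zero_lt_one.trans_le Fact.out).ne'
  have hr0 : r ≠ 0 := (zero_lt_one.trans_le Fact.out).ne'
  have hpq : q ≤ p := ENNReal.HolderTriple.le p r q
  have hq : q ≠ ∞ := ne_top_of_le_ne_top hp hpq
  have hpp := ENNReal.toReal_pos hp0 hp
  have hqp := ENNReal.toReal_pos hq0 hq
  have hrp := ENNReal.toReal_pos hr0 hr
  -- With `t = r / p`, the relation `1/r + 1/p = 1/q` gives `p t = r` and `q (t + 1) = r`, so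
  -- `|u|^t` has `L^p` norm `‖u‖^t` and `u |u|^t` has `L^q` norm `‖u‖^(t+1)`.
  obtain ⟨t, ht⟩ : ∃ t, t = r.toReal / p.toReal := ⟨_, rfl⟩
  have ht0 : 0 < t := ht ▸ by positivity
  have hpt : p * ENNReal.ofReal t = r := by
    rw [← ENNReal.toReal_eq_toReal_iff' (by finiteness) hr, ENNReal.toReal_mul,
      ENNReal.toReal_ofReal ht0.le, ht]
    field_simp
  have hqt : q * ENNReal.ofReal (t + 1) = r := by
    rw [← ENNReal.toReal_eq_toReal_iff' (by finiteness) hr, ENNReal.toReal_mul,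
      ENNReal.toReal_ofReal (by positivity), ht]
    have h := congrArg ENNReal.toReal (ENNReal.HolderTriple.inv_add_inv_eq_inv r p q)
    rw [ENNReal.toReal_add (by simpa) (by simpa), ENNReal.toReal_inv, ENNReal.toReal_inv,
      ENNReal.toReal_inv] at h
    field_simp at h ⊢
    linarith
  have hae : AEStronglyMeasurable (fun z => ((‖u z‖ ^ t : ℝ) : ℂ)) (torusMeasure N) := by
    refine Complex.continuous_ofReal.comp_aestronglyMeasurable ?_
    exact (Real.continuous_rpow_const ht0.le).comp_aestronglyMeasurable
      (Lp.aestronglyMeasurable u).norm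
  have hnorm : eLpNorm (fun z => ((‖u z‖ ^ t : ℝ) : ℂ)) p (torusMeasure N) =
      eLpNorm u r (torusMeasure N) ^ t := by
    have h := eLpNorm_norm_rpow (p := p) (μ := torusMeasure N) u ht0
    rw [hpt] at h
    rw [← h]
    exact eLpNorm_congr_norm_ae (by simp)
  have hmem : MemLp (fun z => ((‖u z‖ ^ t : ℝ) : ℂ)) p (torusMeasure N) :=
    ⟨hae, by
      rw [hnorm]
      exact ENNReal.rpow_lt_top_of_nonneg ht0.le (Lp.eLpNorm_ne_top u)⟩
  have hf : ‖hmem.toLp‖ = ‖u‖ ^ t := by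
    rw [Lp.norm_toLp, hnorm, ← ENNReal.toReal_rpow, Lp.norm_def]
  have huf : ‖lpMul N p q r u hmem.toLp‖ = ‖u‖ ^ (t + 1) := by
    rw [Lp.norm_def, Lp.norm_def, ENNReal.toReal_rpow]
    congr 1
    have h := eLpNorm_norm_rpow (p := q) (μ := torusMeasure N) u (add_pos ht0 one_pos)
    rw [hqt] at h
    rw [← h]
    refine eLpNorm_congr_norm_ae ?_
    filter_upwards [coeFn_lpMul (q := q) u hmem.toLp, hmem.coeFn_toLp] with z h1 h2
    rw [h1, h2, norm_mul, Complex.norm_real, Real.norm_of_nonneg (by positivity),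
      Real.norm_of_nonneg (by positivity), Real.rpow_add_one' (norm_nonneg _) (by positivity),
      mul_comm]
  have key := hC hmem.toLp
  rw [hf, huf] at key
  -- Cancelling `‖u‖ ^ t` requires `u ≠ 0`.
  rcases (norm_nonneg u).eq_or_lt with h0 | h0
  · rwa [← h0]
  · rw [Real.rpow_add_one h0.ne', mul_comm] at key
    exact le_of_mul_le_mul_right key (by positivity)

end Multiplication

theorem ENNReal.holderTriple_of_eq_mul_div_sub {p q r : ℝ≥0∞} (hq0 : q ≠ 0) (hqp : q < p)
    (hp : p ≠ ∞) (hr : r = p * q / (p - q)) : ENNReal.HolderTriple r p q := by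
  have hq : q ≠ ∞ := hqp.ne_top
  have hp0 : p ≠ 0 := hqp.ne_bot
  have hd0 : p - q ≠ 0 := (tsub_pos_of_lt hqp).ne'
  constructor
  rw [hr, ENNReal.inv_div (.inl (by finiteness)) (.inl hd0)]
  rw [← ENNReal.toReal_eq_toReal_iff' (by finiteness) (by finiteness),
    ENNReal.toReal_add (by finiteness) (by finiteness), ENNReal.toReal_div,
    ENNReal.toReal_sub_of_le hqp.le hp, ENNReal.toReal_mul, ENNReal.toReal_inv, ENNReal.toReal_inv]
  have := ENNReal.toReal_pos hp0 hp
  have := ENNReal.toReal_pos hq0 hq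
  field_simp
  ring

theorem mainTheorem10 (N : ℕ∞) (hN : 1 ≤ N) (p q r : ℝ≥0∞)
    [Fact (1 ≤ p)] [Fact (1 ≤ q)] [Fact (1 ≤ r)]
    (hqp : q < p) (hp : p ≠ ∞) (hr : r = p * q / (p - q))
    (u : hardySpace N r) :
    ∃ M : hardySpace N p →L[ℂ] hardySpace N q,
      (∀ f : hardySpace N p,
        ((M f : Lp ℂ q (torusMeasure N)) : Polytorus N → ℂ) =ᵐ[torusMeasure N]
          fun z => (u : Lp ℂ r (torusMeasure N)) z * (f : Lp ℂ p (torusMeasure N)) z) ∧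
      essentialNorm M = ‖u‖ := by
  have hq0 : q ≠ 0 := (zero_lt_one.trans_le Fact.out).ne'
  have hrt : r ≠ ∞ := by
    rw [hr]
    exact ENNReal.div_ne_top (ENNReal.mul_ne_top hp hqp.ne_top) (tsub_pos_of_lt hqp).ne'
  have := ENNReal.holderTriple_of_eq_mul_div_sub hq0 hqp hp hr
  refine ⟨hardyMul p q u, fun f => coeFn_lpMul u.1 f.1, le_antisymm ?_ ?_⟩
  · have hbdd : BddBelow (Set.range fun K : {K : hardySpace N p →L[ℂ] hardySpace N q //
        IsCompactOperator K} => ‖hardyMul p q u - K.1‖) :=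
      ⟨0, by rintro _ ⟨K, rfl⟩; exact ContinuousLinearMap.opNorm_nonneg _⟩
    refine (ciInf_le hbdd ⟨0, isCompactOperator_zero⟩).trans ?_
    rw [sub_zero]
    exact norm_hardyMul_le u
  · have : Nonempty {K : hardySpace N p →L[ℂ] hardySpace N q // IsCompactOperator K} :=
      ⟨⟨0, isCompactOperator_zero⟩⟩
    exact le_ciInf fun K => norm_le_of_norm_lpMul_le hp hrt u.1 (ContinuousLinearMap.opNorm_nonneg _)
      (norm_lpMul_le_of_isCompactOperator hN hp u K.2)
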